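/- Let $\mathcal G=(\mathcal V,\mathcal E)$ be a finite connected undirected graph, and for each node $p\in\mathcal V$ let $\emptyset\ne S_p\subseteq\{1,\dots,n\}$ and let $f_p:\mathbb R^{S_p}\to\mathbb R\cup\{+\infty\}$ be closed (closed epigraph), convex and not identically $+\infty$. Consider $$\text{(P)}\qquad \underset{x\in\mathbb R^n}{\text{minimize}}\ \sum_{p\in\mathcal V} f_p(x_{S_p}),$$ where $x_{S_p}=(x_l)_{l\in S_p}$. For $l\in\{1,\dots,n\}$ let $\mathcal V_l=\{p: l\in S_p\}$ and let $\mathcal G_l$ be the subgraph of $\mathcal G$ induced by $\mathcal V_l$; let $\mathcal N_p$ be the set of neighbors of $p$ and, for $l\in S_p$, let $D_{p,l}=|\mathcal N_p\cap\mathcal V_l|$. Let $C(\cdot):\mathcal V\to\{1,\dots,C\}$ be a proper coloring of $\mathcal G$ that uses all $C$ colors, and let $\mathcal C_c$ be the set of nodes of color $c$. Assume: 1. (P) has a solution (with finite optimal value); 2. $\bigcup_p S_p=\{1,\dots,n\}$, and every component $l$ belongs to at least two of the sets $S_p$; 3. the variable is connected, i.e. every $\mathcal G_l$ is connected; 4.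 strong duality holds for the reformulation of (P) with copies, i.e. minimize $\sum_p f_p(z^{(p)})$ over $z^{(p)}\in\mathbb R^{S_p}$, $p\in\mathcal V$, subject to $z^{(i)}_l=z^{(j)}_l$ for every $l$ and every edge $(i,j)$ of $\mathcal G_l$: there are multipliers $\lambda_l^{ij}$, one for each of these constraints, such that the infimum over all $z$ of the Lagrangian $\sum_p f_p(z^{(p)})+\sum_l\sum_{(i,j)}\lambda_l^{ij}(z_l^{(i)}-z_l^{(j)})$ equals the optimal value of (P). Let $\rho>0$. The algorithm starts from $x^{(p),0}_l=\gamma^{(p),0}_l=0$ for all $p$ and $l\in S_p$. At iteration $k=0,1,2,\dots$, for $c=1,\dots,C$ in this order, every node $p\in\mathcal C_c$ computes $$v_l^{(p),k}=\gamma_l^{(p),k}-\rho\sum_{j\in\mathcal N_p\cap\mathcal V_l,\ C(j)<c}x_l^{(j),k+1}-\rho\sum_{j\in\mathcal N_p\cap\mathcal V_l,\ C(j)>c}x_l^{(j),k}\qquad(l\in S_p),$$ $$x^{(p),k+1}=\underset{u\in\mathbb R^{S_p}}{\arg\min}\ f_p(u)+\sum_{l\in S_p}v_l^{(p),k}u_l+\frac{\rho}{2}\sum_{l\in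 S_p}D_{p,l}\,u_l^2;$$ then, for all $p$ and $l\in S_p$, $$\gamma_l^{(p),k+1}=\gamma_l^{(p),k}+\rho\sum_{j\in\mathcal N_p\cap\mathcal V_l}\bigl(x_l^{(p),k+1}-x_l^{(j),k+1}\bigr).$$ Suppose that at least one of the following holds: (a) $C=2$; (b) each $f_p$ is strongly convex with modulus $\mu_p>0$ and $$\rho<\min_{c=1,\dots,C}\ \frac{2\sum_{p\in\mathcal C_c}\mu_p}{3\,(C-1)\,\max_{p\in\mathcal C_c,\ l\in S_p}D_{p,l}}.$$ Then the algorithm is well defined (it produces exactly one sequence), and there is a solution $x^\star$ of (P) such that $x^{(p),k}\to x^\star_{S_p}$ as $k\to\infty$ for every $p\in\mathcal V$. -/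

import Mathlib

open Filter Topology

noncomputable section

namespace ConnVar

/-- Families `(z^{(p)})_p` with `z^{(p)} = (z_l^{(p)})_{l ∈ S_p} ∈ ℝ^{S_p}` (one real number for every
node `p` and every component `l ∈ S_p`), each `ℝ^{S_p}` with its Euclidean structure. -/
abbrev Copies {V : Type*} {n : ℕ} (S : V → Finset (Fin n)) : Type _ :=
  ∀ p : V, EuclideanSpace ℝ (S p)

/-- The epigraph of an extended real-valued function `g : E → ℝ ∪ {+∞}`. -/
def epigraph {E : Type*} (g : E → WithTop ℝ) : Set (E × ℝ) :=
  {q | g q.1 ≤ (q.2 : WithTop ℝ)}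

/-- `g : E → ℝ ∪ {+∞}` is closed, convex and not identically `+∞`. -/
structure IsClosedConvexProper {E : Type*} [NormedAddCommGroup E] [NormedSpace ℝ E]
    (g : E → WithTop ℝ) : Prop where
  closed : IsClosed (epigraph g)
  convex : Convex ℝ (epigraph g)
  proper : ∃ x, g x ≠ ⊤

/-- `g : E → ℝ ∪ {+∞}` is strongly convex with modulus `μ > 0`:
`g ((1-t) x + t y) ≤ (1-t) g x + t g y - (μ/2) t (1-t) ‖x - y‖²` on the (convex) effective domain. -/
def IsStronglyConvex {E : Type*} [NormedAddCommGroup E] [NormedSpace ℝ E]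
    (μ : ℝ) (g : E → WithTop ℝ) : Prop :=
  0 < μ ∧ StrongConvexOn {x | g x ≠ ⊤} μ (fun x => (g x).untopD 0)

variable {V : Type*} {n C : ℕ}

/-- The subvector `x_{S_p}` of `x ∈ ℝⁿ`, for every node `p`. -/
def restrict (S : V → Finset (Fin n)) (x : EuclideanSpace ℝ (Fin n)) : Copies S :=
  fun _ => WithLp.toLp 2 fun l => x l.1

/-- The value `z_l^{(j)}`, for a node `j` with `l ∈ S_j` (it is only ever used for such `j`). -/
def entry {S : V → Finset (Fin n)} (z : Copies S) (j : V) (l : Fin n) : ℝ :=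
  if h : l ∈ S j then z j ⟨l, h⟩ else 0

/-- The subgraph of the network `G` induced by the component `x_l`: its nodes are the `p` with
`l ∈ S_p`. -/
def inducedSubgraph (G : SimpleGraph V) (S : V → Finset (Fin n)) (l : Fin n) :
    SimpleGraph {p : V // l ∈ S p} :=
  G.induce {p : V | l ∈ S p}

/-- The variable is connected: every component induces a connected subgraph. -/
def IsConnectedVariable (G : SimpleGraph V) (S : V → Finset (Fin n)) : Prop :=
  ∀ l, (inducedSubgraph G S l).Connected

variable [Fintype V]

/-- The objective `f_1(x_{S_1}) + ⋯ + f_P(x_{S_P})`. -/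
def objective (S : V → Finset (Fin n)) (f : ∀ p : V, EuclideanSpace ℝ (S p) → WithTop ℝ)
    (x : EuclideanSpace ℝ (Fin n)) : WithTop ℝ :=
  ∑ p, f p (restrict S x p)

/-- `x` solves: minimize `f_1(x_{S_1}) + ⋯ + f_P(x_{S_P})` over `x ∈ ℝⁿ` (with a finite value). -/
def IsSolution (S : V → Finset (Fin n)) (f : ∀ p : V, EuclideanSpace ℝ (S p) → WithTop ℝ)
    (x : EuclideanSpace ℝ (Fin n)) : Prop :=
  objective S f x ≠ ⊤ ∧ ∀ y, objective S f x ≤ objective S f y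

open scoped Classical in
/-- `𝒩_p ∩ 𝒱_l`: the neighbours of node `p` whose functions depend on the component `l`. -/
def nbrs (G : SimpleGraph V) (S : V → Finset (Fin n)) (p : V) (l : Fin n) : Finset V :=
  {j : V | G.Adj p j ∧ l ∈ S j}

/-- `D_{p,l}`: the degree of node `p` in the subgraph induced by `x_l` (used for `l ∈ S_p`). -/
def deg (G : SimpleGraph V) (S : V → Finset (Fin n)) (p : V) (l : Fin n) : ℕ :=
  (nbrs G S p l).card

/-- The nodes with color `c`. -/
def colorSet {G : SimpleGraph V} (col : G.Coloring (Fin C)) (c : Fin C) : Finset V :=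
  {p : V | col p = c}

/-- `max_{p ∈ 𝒞_c, l ∈ S_p} D_{p,l}`. -/
def maxDeg (G : SimpleGraph V) (S : V → Finset (Fin n)) (col : G.Coloring (Fin C))
    (c : Fin C) : ℕ :=
  (colorSet col c).sup fun p => (S p).sup fun l => deg G S p l

/-- The Lagrangian of the problem with copies: minimize `∑_p f_p(z^{(p)})` subject to
`z_l^{(i)} = z_l^{(j)}` for every `l` and every edge `(i,j)` of the subgraph induced by `x_l`;
an edge `(i,j)` is written so that the color of `i` is smaller than that of `j`. -/
def lagrangian (G : SimpleGraph V) (S : V → Finset (Fin n))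
    (f : ∀ p : V, EuclideanSpace ℝ (S p) → WithTop ℝ) (col : G.Coloring (Fin C))
    (lam : Fin n → V → V → ℝ) (z : Copies S) : WithTop ℝ :=
  ∑ p, f p (z p) +
    ((∑ i, ∑ l ∈ S i, ∑ j ∈ nbrs G S i l with col i < col j,
      lam l i j * (entry z i l - entry z j l) : ℝ) : WithTop ℝ)

/-- Strong duality between the problem with copies and its Lagrangian dual: for some multiplier
`lam` the infimum over all `z` of the Lagrangian is the optimal value. -/
def StrongDuality (G : SimpleGraph V) (S : V → Finset (Fin n))
    (f : ∀ p : V, EuclideanSpace ℝ (S p) → WithTop ℝ) (col : G.Coloring (Fin C)) : Prop :=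
  ∃ lam : Fin n → V → V → ℝ, ∀ x, IsSolution S f x →
    ∀ z : Copies S, objective S f x ≤ lagrangian G S f col lam z

/-- `v_l^{(p),k}` computed from `γ^k`, the new estimates `x^{k+1}` of the neighbours of smaller color
and the old estimates `x^k` of the neighbours of larger color. -/
def vStep (G : SimpleGraph V) (S : V → Finset (Fin n)) (col : G.Coloring (Fin C)) (ρ : ℝ)
    (γ xOld xNew : Copies S) (p : V) (l : S p) : ℝ :=
  γ p l - ρ * ∑ j ∈ nbrs G S p l with col j < col p, entry xNew j l
        - ρ * ∑ j ∈ nbrs G S p l with col p < col j, entry xOld j l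

/-- `x` and `γ` are sequences produced by the algorithm with parameter `ρ`. -/
structure IsRun (G : SimpleGraph V) (S : V → Finset (Fin n))
    (f : ∀ p : V, EuclideanSpace ℝ (S p) → WithTop ℝ) (col : G.Coloring (Fin C)) (ρ : ℝ)
    (x γ : ℕ → Copies S) : Prop where
  x_zero : ∀ p, x 0 p = 0
  γ_zero : ∀ p, γ 0 p = 0
  x_step : ∀ k p, IsMinOn
    (fun u : EuclideanSpace ℝ (S p) => f p u +
      ((∑ l : S p, vStep G S col ρ (γ k) (x k) (x (k + 1)) p l * u l +
        ρ / 2 * ∑ l : S p, (deg G S p l : ℝ) * u l ^ 2 : ℝ) : WithTop ℝ))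
    Set.univ (x (k + 1) p)
  γ_step : ∀ k p (l : S p), γ (k + 1) p l =
    γ k p l + ρ * ∑ j ∈ nbrs G S p l, (x (k + 1) p l - entry (x (k + 1)) j l)

end ConnVar

end

noncomputable section

namespace ConnVar

/-! ### Subgradients of extended-valued convex functions and the local minimization problems. -/

section Convex

/-! Every edge `(i, j)` of the subgraph of a component, with `i` of lower color, gets its own
multiplier: the running sum `edgeDual` of `x_i - x_j`. Then `γ` is `ρ` times the sum of the
multipliers at a node, and optimality of the local step says that `-ρ * nodeGrad` is a subgradient
of `f_p` at the new point. Strong duality supplies a saddle point: a consensus value and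
antisymmetric multipliers whose nodewise sums, times `-ρ`, are subgradients there
(`exists_isSaddle`). Monotonicity at each node, summed and regrouped by edges, makes the energy
`lyapunov` drop by at least the sum of `(x_i^{k+1} - x_j^k)^2` over the edges (`lyapunov_succ_le`).
Hence all sequences are bounded and `x_i^{k+1} - x_j^k → 0`.

This compares two different iterations, so consensus in the limit also requires `x^{k+1} - x^k → 0`.
`tendsto_diff_zero` proves it by descending induction on the color: an edge to a higher color passes
the property down, and at components without such an edge the proximal term makes consecutive
subgradients strongly monotone up to vanishing errors. By closedness of the subgradient relation a
cluster point is then a saddle point. The energy relative to that point decreases and vanishes along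
a subsequence, so it tends to zero, which gives convergence of the whole sequence
(`tendsto_of_lyapunov_subseq`). -/

theorem lowerSemicontinuous_add_coe {E : Type*} [TopologicalSpace E] {g : E → WithTop ℝ}
    (hg : IsClosed (epigraph g)) {Q : E → ℝ} (hQ : Continuous Q) :
    LowerSemicontinuous fun w => g w + (Q w : WithTop ℝ) := by
  rw [lowerSemicontinuous_iff_isClosed_preimage]
  intro y
  induction y with
  | top => simp
  | coe r =>
    have : (fun w => g w + (Q w : WithTop ℝ)) ⁻¹' Set.Iic (r : WithTop ℝ) =
        (fun w => (w, r - Q w)) ⁻¹' epigraph g := by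
      ext w
      simp only [Set.mem_preimage, Set.mem_Iic, epigraph, Set.mem_ofPred_eq]
      induction g w with
      | top => simp
      | coe b => rw [← WithTop.coe_add, WithTop.coe_le_coe, WithTop.coe_le_coe, le_sub_iff_add_le]
    rw [this]
    exact hg.preimage (by fun_prop)

variable {ι : Type*} [Fintype ι]

/-- `q` is a subgradient of `g` at `u`, a point of the effective domain. -/
def IsSubgradient (g : EuclideanSpace ℝ ι → WithTop ℝ) (u : EuclideanSpace ℝ ι) (q : ι → ℝ) :
    Prop :=
  ∃ a : ℝ, g u = a ∧ ∀ w (b : ℝ), g w ≤ b → a + ∑ l, q l * (w l - u l) ≤ b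

theorem IsSubgradient.monotone {g : EuclideanSpace ℝ ι → WithTop ℝ} {u u' : EuclideanSpace ℝ ι}
    {q q' : ι → ℝ} (h : IsSubgradient g u q) (h' : IsSubgradient g u' q') :
    0 ≤ ∑ l, (q l - q' l) * (u l - u' l) := by
  obtain ⟨a, ha, h⟩ := h
  obtain ⟨a', ha', h'⟩ := h'
  have h1 := h u' a' ha'.le
  have h2 := h' u a ha.le
  have h3 : ∑ l, (q l - q' l) * (u l - u' l) =
      -(∑ l, q l * (u' l - u l) + ∑ l, q' l * (u l - u' l)) := by
    rw [← Finset.sum_add_distrib, ← Finset.sum_neg_distrib]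
    exact Finset.sum_congr rfl fun l _ => by ring
  linarith

/-- The quadratic part of the local problems. -/
def localQuad (v d : ι → ℝ) (ρ : ℝ) (u : EuclideanSpace ℝ ι) : ℝ :=
  ∑ l, v l * u l + ρ / 2 * ∑ l, d l * u l ^ 2

theorem localQuad_add_smul (v d : ι → ℝ) (ρ t : ℝ) (u w : EuclideanSpace ℝ ι) :
    localQuad v d ρ ((1 - t) • u + t • w) = localQuad v d ρ u
      + t * ∑ l, (v l + ρ * d l * u l) * (w l - u l)
      + t ^ 2 * (ρ / 2 * ∑ l, d l * (w l - u l) ^ 2) := by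
  simp only [localQuad, Finset.mul_sum, ← Finset.sum_add_distrib, PiLp.add_apply, PiLp.smul_apply,
    smul_eq_mul]
  exact Finset.sum_congr rfl fun l _ => by ring

theorem continuous_localQuad (v d : ι → ℝ) (ρ : ℝ) : Continuous (localQuad v d ρ) := by
  unfold localQuad
  fun_prop

theorem isSubgradient_of_isMinOn {g : EuclideanSpace ℝ ι → WithTop ℝ}
    (hg : IsClosedConvexProper g) {v d : ι → ℝ} {ρ : ℝ} {u : EuclideanSpace ℝ ι}
    (hu : IsMinOn (fun w => g w + (localQuad v d ρ w : WithTop ℝ)) Set.univ u) :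
    IsSubgradient g u fun l => -(v l + ρ * d l * u l) := by
  obtain ⟨a, ha⟩ : ∃ a : ℝ, g u = a := by
    obtain ⟨y, hy⟩ := hg.proper
    obtain ⟨b, hb⟩ := WithTop.ne_top_iff_exists.1 hy
    have h := hu (Set.mem_univ y)
    simp only [Set.mem_ofPred_eq, ← hb] at h
    obtain ⟨a, ha⟩ : ∃ a : ℝ, (a : WithTop ℝ) = g u := by
      rw [← WithTop.ne_top_iff_exists]
      intro htop
      rw [htop, WithTop.top_add, top_le_iff, ← WithTop.coe_add] at h
      exact WithTop.coe_ne_top h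
    exact ⟨a, ha.symm⟩
  refine ⟨a, ha, fun w b hw => ?_⟩
  set L := ∑ l, (v l + ρ * d l * u l) * (w l - u l)
  set R := ρ / 2 * ∑ l, d l * (w l - u l) ^ 2
  -- Compare `u` with the point at parameter `t` on the segment to `w`: convexity bounds `g`
  -- linearly in `t`, the quadratic part adds `t * L + t ^ 2 * R`, and dividing by `t` leaves an
  -- inequality whose limit `t → 0` is the subgradient inequality.
  have key : ∀ t : ℝ, 0 < t → t ≤ 1 → 0 ≤ (b - a + L) + t * R := by
    intro t ht ht1
    have hmem := hg.convex (x := (u, a)) (y := (w, b)) ha.le hw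
      (sub_nonneg.2 ht1) ht.le (by ring)
    have h1 : g ((1 - t) • u + t • w) ≤ (((1 - t) * a + t * b : ℝ) : WithTop ℝ) := hmem
    have h2 := hu (Set.mem_univ ((1 - t) • u + t • w))
    simp only [Set.mem_ofPred_eq, ha] at h2
    have h3 := h2.trans (add_le_add_left h1 _)
    rw [← WithTop.coe_add, ← WithTop.coe_add, WithTop.coe_le_coe, localQuad_add_smul] at h3
    have h4 : 0 ≤ t * ((b - a + L) + t * R) := by
      change _ ≤ (1 - t) * a + t * b + (localQuad v d ρ u + t * L + t ^ 2 * R) at h3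
      nlinarith [h3]
    exact nonneg_of_mul_nonneg_right h4 ht
  have hlim : Tendsto (fun t : ℝ => (b - a + L) + t * R) (𝓝[>] 0) (𝓝 ((b - a + L) + 0 * R)) :=
    Tendsto.mono_left (Continuous.tendsto (by fun_prop) 0) nhdsWithin_le_nhds
  have h0 : 0 ≤ (b - a + L) + 0 * R := by
    refine ge_of_tendsto hlim ?_
    filter_upwards [Ioc_mem_nhdsGT (zero_lt_one' ℝ)] with t ht using key t ht.1 ht.2
  have hL : ∑ l, -(v l + ρ * d l * u l) * (w l - u l) = -L := by
    simp only [L, ← Finset.sum_neg_distrib, neg_mul]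
  rw [hL]
  linarith

/-- One subgradient bounds `g` below by an affine function, so the quadratic term, nondegenerate
since `1 ≤ d l`, makes sublevel sets bounded; lower semicontinuity then yields a minimizer. -/
theorem exists_isMinOn_add_localQuad {g : EuclideanSpace ℝ ι → WithTop ℝ}
    (hg : IsClosed (epigraph g)) {u : EuclideanSpace ℝ ι} {q : ι → ℝ} (hq : IsSubgradient g u q)
    {v d : ι → ℝ} {ρ : ℝ} (hρ : 0 < ρ) (hd : ∀ l, 1 ≤ d l) :
    ∃ w, IsMinOn (fun w => g w + (localQuad v d ρ w : WithTop ℝ)) Set.univ w := by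
  set h : EuclideanSpace ℝ ι → WithTop ℝ := fun w => g w + (localQuad v d ρ w : WithTop ℝ) with hh
  have hlsc : LowerSemicontinuous h := lowerSemicontinuous_add_coe hg (continuous_localQuad v d ρ)
  set K := h ⁻¹' Set.Iic (h u) with hK
  have hKc : IsClosed K := (lowerSemicontinuous_iff_isClosed_preimage.1 hlsc) _
  obtain ⟨a, ha, hmin⟩ := hq
  -- Half of `ρ / 2 * ‖w‖ ^ 2` absorbs the linear terms by completing the square; the remaining `ρ /
  -- 4` gives the factor `4 / ρ`.
  have hbound : ∀ w ∈ K, ‖w‖ ^ 2 ≤ 4 / ρ * (localQuad v d ρ u + ∑ l, q l * u l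
      + ∑ l, (q l + v l) ^ 2 / ρ) := by
    intro w hw
    have hw' : g w ≤ ((a + localQuad v d ρ u - localQuad v d ρ w : ℝ) : WithTop ℝ) := by
      have : g w + (localQuad v d ρ w : WithTop ℝ) ≤ g u + (localQuad v d ρ u : WithTop ℝ) := hw
      rw [ha] at this
      revert this
      induction g w with
      | top => intro h; simp [← WithTop.coe_add] at h
      | coe b =>
        rw [← WithTop.coe_add, ← WithTop.coe_add, WithTop.coe_le_coe, WithTop.coe_le_coe]
        intro h
        linarith
    have h1 := hmin w _ hw'
    have h2 : ρ / 4 * ‖w‖ ^ 2 ≤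
        (∑ l, q l * (w l - u l) + localQuad v d ρ w) + ∑ l, q l * u l
          + ∑ l, (q l + v l) ^ 2 / ρ := by
      rw [EuclideanSpace.norm_sq_eq, localQuad, Finset.mul_sum, Finset.mul_sum,
        ← Finset.sum_add_distrib, ← Finset.sum_add_distrib, ← Finset.sum_add_distrib,
        ← Finset.sum_add_distrib]
      refine Finset.sum_le_sum fun l _ => ?_
      rw [Real.norm_eq_abs, sq_abs]
      have h3 : ρ / 2 * w l ^ 2 ≤ ρ / 2 * (d l * w l ^ 2) := by
        have := mul_le_mul_of_nonneg_right (hd l) (sq_nonneg (w l))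
        have h5 : 0 ≤ ρ / 2 := by positivity
        nlinarith [mul_le_mul_of_nonneg_left this h5]
      have h4 : 0 ≤ (ρ / 2 * w l + (q l + v l)) ^ 2 / ρ := by positivity
      have h5 : (ρ / 2 * w l + (q l + v l)) ^ 2 / ρ =
          ρ / 4 * w l ^ 2 + (q l + v l) * w l + (q l + v l) ^ 2 / ρ := by
        field_simp
        ring
      nlinarith
    have h6 : ρ / 4 * ‖w‖ ^ 2 ≤ localQuad v d ρ u + ∑ l, q l * u l
      + ∑ l, (q l + v l) ^ 2 / ρ := by linarith
    calc ‖w‖ ^ 2 = 4 / ρ * (ρ / 4 * ‖w‖ ^ 2) := by field_simp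
      _ ≤ _ := by gcongr
  have hcomp : IsCompact K := by
    refine Metric.isCompact_of_isClosed_isBounded hKc ?_
    refine isBounded_iff_forall_norm_le.2 ⟨_, fun w hw => Real.le_sqrt_of_sq_le (hbound w hw)⟩
  obtain ⟨w, hwK, hw⟩ := (hlsc.lowerSemicontinuousOn K).exists_isMinOn ⟨u, le_refl (h u)⟩ hcomp
  refine ⟨w, fun y _ => ?_⟩
  by_cases hy : y ∈ K
  · exact hw hy
  · exact (le_trans hwK (not_le.1 hy).le : h w ≤ h y)

/-- Each subgradient inequality places a point `(u k, ·)` in the epigraph, which is closed;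
properness of `g` then forces a finite value at the limit. -/
theorem isSubgradient_of_tendsto {g : EuclideanSpace ℝ ι → WithTop ℝ}
    (hg : IsClosedConvexProper g) {u : ℕ → EuclideanSpace ℝ ι} {q : ℕ → ι → ℝ}
    {u' : EuclideanSpace ℝ ι} {q' : ι → ℝ} (h : ∀ k, IsSubgradient g (u k) (q k))
    (hu : Tendsto u atTop (𝓝 u')) (hq : ∀ l, Tendsto (fun k => q k l) atTop (𝓝 (q' l))) :
    IsSubgradient g u' q' := by
  have key : ∀ w (b : ℝ), g w ≤ b → g u' ≤ ((b - ∑ l, q' l * (w l - u' l) : ℝ) : WithTop ℝ) := by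
    intro w b hw
    have hl : ∀ l, Tendsto (fun k => u k l) atTop (𝓝 (u' l)) := fun l =>
      ((EuclideanSpace.proj (𝕜 := ℝ) l).continuous.tendsto u').comp hu
    have hlim : Tendsto (fun k => (u k, b - ∑ l, q k l * (w l - u k l))) atTop
        (𝓝 (u', b - ∑ l, q' l * (w l - u' l))) := by
      refine hu.prodMk_nhds (tendsto_const_nhds.sub (tendsto_finsetSum _ fun l _ => ?_))
      exact (hq l).mul (tendsto_const_nhds.sub (hl l))
    refine hg.closed.mem_of_tendsto hlim (Eventually.of_forall fun k => ?_)
    obtain ⟨a, ha, h'⟩ := h k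
    change g (u k) ≤ _
    rw [ha, WithTop.coe_le_coe]
    linarith [h' w b hw]
  obtain ⟨y, hy⟩ := hg.proper
  obtain ⟨b, hb⟩ := WithTop.ne_top_iff_exists.1 hy
  obtain ⟨a, ha⟩ := WithTop.ne_top_iff_exists.1
    (ne_top_of_le_ne_top WithTop.coe_ne_top (key y b hb.ge))
  refine ⟨a, ha.symm, fun w b hw => ?_⟩
  have := key w b hw
  rw [← ha, WithTop.coe_le_coe] at this
  linarith

end Convex

/-! ### The edge energy and its decrease. -/

section EdgeEnergy

open scoped Classical

variable {V L κ : Type*}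

/-- The accumulated disagreement `∑_{t=1}^k (x_i^t - x_j^t)` along the edge `(i, j)`. -/
def edgeDual (A : L → V → V → Prop) (X : ℕ → V → L → ℝ) (k : ℕ) (l : L) (i j : V) : ℝ :=
  if A l i j then ∑ t ∈ Finset.range k, (X (t + 1) i l - X (t + 1) j l) else 0

theorem edgeDual_succ {A : L → V → V → Prop} {l : L} {i j : V} (h : A l i j)
    (X : ℕ → V → L → ℝ) (k : ℕ) :
    edgeDual A X (k + 1) l i j = edgeDual A X k l i j + (X (k + 1) i l - X (k + 1) j l) := by
  simp only [edgeDual, h, if_true, Finset.sum_range_succ]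

theorem edgeDual_swap {A : L → V → V → Prop} (hsymm : ∀ l i j, A l i j → A l j i)
    (X : ℕ → V → L → ℝ) (k : ℕ) (l : L) (i j : V) :
    edgeDual A X k l j i = -edgeDual A X k l i j := by
  unfold edgeDual
  by_cases h : A l i j
  · rw [if_pos h, if_pos (hsymm l i j h), ← Finset.sum_neg_distrib]
    exact Finset.sum_congr rfl fun t _ => by ring
  · rw [if_neg h, if_neg fun h' => h (hsymm l j i h'), neg_zero]

variable [Fintype V] [Fintype L] [LinearOrder κ]

/-- Sum over the edges `(i, j)` of all the graphs `A l`, written with `col i < col j`. -/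
def edgeSum (A : L → V → V → Prop) (col : V → κ) (φ : L → V → V → ℝ) : ℝ :=
  ∑ l, ∑ i, ∑ j with A l i j ∧ col i < col j, φ l i j

theorem edgeSum_mono {A : L → V → V → Prop} {col : V → κ} {φ ψ : L → V → V → ℝ}
    (h : ∀ l i j, A l i j → col i < col j → φ l i j ≤ ψ l i j) :
    edgeSum A col φ ≤ edgeSum A col ψ :=
  Finset.sum_le_sum fun l _ => Finset.sum_le_sum fun i _ => Finset.sum_le_sum fun j hj =>
    h l i j (Finset.mem_filter.1 hj).2.1 (Finset.mem_filter.1 hj).2.2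

theorem edgeSum_congr {A : L → V → V → Prop} {col : V → κ} {φ ψ : L → V → V → ℝ}
    (h : ∀ l i j, A l i j → col i < col j → φ l i j = ψ l i j) :
    edgeSum A col φ = edgeSum A col ψ :=
  le_antisymm (edgeSum_mono fun l i j h1 h2 => (h l i j h1 h2).le)
    (edgeSum_mono fun l i j h1 h2 => (h l i j h1 h2).ge)

theorem edgeSum_add (A : L → V → V → Prop) (col : V → κ) (φ ψ : L → V → V → ℝ) :
    edgeSum A col (fun l i j => φ l i j + ψ l i j) = edgeSum A col φ + edgeSum A col ψ := by
  simp only [edgeSum, Finset.sum_add_distrib]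

theorem edgeSum_sub (A : L → V → V → Prop) (col : V → κ) (φ ψ : L → V → V → ℝ) :
    edgeSum A col (fun l i j => φ l i j - ψ l i j) = edgeSum A col φ - edgeSum A col ψ := by
  simp only [edgeSum, Finset.sum_sub_distrib]

theorem le_edgeSum {A : L → V → V → Prop} {col : V → κ} {φ : L → V → V → ℝ}
    (h : ∀ l i j, 0 ≤ φ l i j) {l : L} {i j : V} (hA : A l i j) (hc : col i < col j) :
    φ l i j ≤ edgeSum A col φ := by
  have h1 : φ l i j ≤ ∑ j with A l i j ∧ col i < col j, φ l i j :=
    Finset.single_le_sum (f := fun j => φ l i j) (fun _ _ => h _ _ _)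
      (Finset.mem_filter.2 ⟨Finset.mem_univ _, hA, hc⟩)
  have h2 := Finset.single_le_sum (s := Finset.univ)
    (f := fun i => ∑ j with A l i j ∧ col i < col j, φ l i j)
    (fun _ _ => Finset.sum_nonneg fun _ _ => h _ _ _) (Finset.mem_univ i)
  have h3 := Finset.single_le_sum (s := Finset.univ)
    (f := fun l => ∑ i, ∑ j with A l i j ∧ col i < col j, φ l i j)
    (fun _ _ => Finset.sum_nonneg fun _ _ => Finset.sum_nonneg fun _ _ => h _ _ _)
    (Finset.mem_univ l)
  exact h1.trans (h2.trans h3)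

theorem edgeSum_nonneg {A : L → V → V → Prop} {col : V → κ} {φ : L → V → V → ℝ}
    (h : ∀ l i j, 0 ≤ φ l i j) : 0 ≤ edgeSum A col φ :=
  Finset.sum_nonneg fun _ _ => Finset.sum_nonneg fun _ _ => Finset.sum_nonneg fun _ _ => h _ _ _

theorem tendsto_edgeSum {A : L → V → V → Prop} {col : V → κ} {φ : ℕ → L → V → V → ℝ}
    {φ' : L → V → V → ℝ} {F : Filter ℕ}
    (h : ∀ l i j, A l i j → col i < col j → Tendsto (fun k => φ k l i j) F (𝓝 (φ' l i j))) :
    Tendsto (fun k => edgeSum A col (φ k)) F (𝓝 (edgeSum A col φ')) :=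
  tendsto_finsetSum _ fun l _ => tendsto_finsetSum _ fun i _ => tendsto_finsetSum _ fun j hj =>
    h l i j (Finset.mem_filter.1 hj).2.1 (Finset.mem_filter.1 hj).2.2

/-- Each edge is seen once from each endpoint; properness of the coloring orients it. This turns
nodewise inequalities into edgewise ones. -/
theorem sum_nbrs_eq_edgeSum {A : L → V → V → Prop} {col : V → κ}
    (hsymm : ∀ l i j, A l i j → A l j i) (hcol : ∀ l i j, A l i j → col i ≠ col j)
    (φ : L → V → V → ℝ) :
    ∑ p, ∑ l, ∑ j with A l p j, φ l p j = edgeSum A col fun l i j => φ l i j + φ l j i := by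
  rw [Finset.sum_comm, edgeSum]
  refine Finset.sum_congr rfl fun l _ => ?_
  simp only [Finset.sum_filter, Finset.sum_add_distrib]
  have h1 : ∑ i, ∑ j, (if A l i j then φ l i j else 0) =
      ∑ i, ∑ j, (if A l i j ∧ col i < col j then φ l i j else 0) +
      ∑ i, ∑ j, (if A l i j ∧ col j < col i then φ l i j else 0) := by
    simp only [← Finset.sum_add_distrib]
    refine Finset.sum_congr rfl fun i _ => Finset.sum_congr rfl fun j _ => ?_
    by_cases hA : A l i j
    · rcases lt_or_gt_of_ne (hcol l i j hA) with h | h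
      · simp [hA, h, h.not_gt]
      · simp [hA, h, h.not_gt]
    · simp [hA]
  have h2 : ∑ i, ∑ j, (if A l i j ∧ col j < col i then φ l i j else 0) =
      ∑ i, ∑ j, (if A l i j ∧ col i < col j then φ l j i else 0) := by
    rw [Finset.sum_comm]
    refine Finset.sum_congr rfl fun i _ => Finset.sum_congr rfl fun j _ => ?_
    rw [show A l j i ↔ A l i j from ⟨hsymm l j i, hsymm l i j⟩]
  rw [h1, h2]

/-- Up to the factor `-ρ`, the subgradient of `f_p` selected by the local step at node `p`. -/
def nodeGrad (A : L → V → V → Prop) (col : V → κ) (X : ℕ → V → L → ℝ) (k : ℕ) (p : V) (l : L) :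
    ℝ :=
  ∑ j with A l p j, (edgeDual A X k l p j +
    (X (k + 1) p l - if col j < col p then X (k + 1) j l else X k j l))

/-- The Lyapunov function: squared distance of the edge multipliers and of the upper endpoints of
the edges to a reference point. -/
def lyapunov (A : L → V → V → Prop) (col : V → κ) (X : ℕ → V → L → ℝ) (s : L → V → V → ℝ)
    (y : L → ℝ) (k : ℕ) : ℝ :=
  edgeSum A col fun l i j => (edgeDual A X k l i j - s l i j) ^ 2 + (X k j l - y l) ^ 2

variable {A : L → V → V → Prop} {col : V → κ} {X : ℕ → V → L → ℝ}

/-- The change of energy plus the squared steps is exactly twice the sum over nodes of the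
quantities in `hmono`, by a polynomial identity on each edge. -/
theorem lyapunov_succ_le (hsymm : ∀ l i j, A l i j → A l j i)
    (hcol : ∀ l i j, A l i j → col i ≠ col j) {s : L → V → V → ℝ} {y : L → ℝ} {k : ℕ}
    (hs : ∀ l i j, A l i j → s l j i = -s l i j)
    (hmono : ∀ p, ∑ l, (nodeGrad A col X k p l - ∑ j with A l p j, s l p j)
      * (X (k + 1) p l - y l) ≤ 0) :
    lyapunov A col X s y (k + 1) + edgeSum A col (fun l i j => (X (k + 1) i l - X k j l) ^ 2)
      ≤ lyapunov A col X s y k := by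
  have h1 : ∑ p, ∑ l, ∑ j with A l p j, (edgeDual A X k l p j +
      (X (k + 1) p l - (if col j < col p then X (k + 1) j l else X k j l)) - s l p j)
      * (X (k + 1) p l - y l) ≤ 0 := by
    refine Finset.sum_nonpos fun p _ => le_of_eq_of_le ?_ (hmono p)
    refine Finset.sum_congr rfl fun l _ => ?_
    rw [nodeGrad, ← Finset.sum_sub_distrib, Finset.sum_mul]
  rw [sum_nbrs_eq_edgeSum hsymm hcol (fun l p j => (edgeDual A X k l p j +
      (X (k + 1) p l - (if col j < col p then X (k + 1) j l else X k j l)) - s l p j)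
      * (X (k + 1) p l - y l))] at h1
  have h2 : lyapunov A col X s y (k + 1)
      + edgeSum A col (fun l i j => (X (k + 1) i l - X k j l) ^ 2)
      - lyapunov A col X s y k = 2 * edgeSum A col (fun l i j => (edgeDual A X k l i j +
      (X (k + 1) i l - (if col j < col i then X (k + 1) j l else X k j l)) - s l i j)
      * (X (k + 1) i l - y l) + (edgeDual A X k l j i +
      (X (k + 1) j l - (if col i < col j then X (k + 1) i l else X k i l)) - s l j i)
      * (X (k + 1) j l - y l)) := by
    rw [two_mul, ← edgeSum_add, lyapunov, lyapunov, ← edgeSum_add, ← edgeSum_sub]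
    refine edgeSum_congr fun l i j hA hc => ?_
    rw [if_pos hc, if_neg hc.not_gt, edgeDual_swap hsymm X k l i j, hs l i j hA,
      edgeDual_succ hA]
    ring
  linarith

/-- The energy is decreasing and nonnegative, so its successive drops, which dominate the squared
steps, tend to zero. -/
theorem tendsto_step_of_lyapunov {s : L → V → V → ℝ} {y : L → ℝ}
    (hdec : ∀ k, lyapunov A col X s y (k + 1)
      + edgeSum A col (fun l i j => (X (k + 1) i l - X k j l) ^ 2) ≤ lyapunov A col X s y k)
    {l : L} {i j : V} (hA : A l i j) (hc : col i < col j) :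
    Tendsto (fun k => X (k + 1) i l - X k j l) atTop (𝓝 0) := by
  have hnn : ∀ k, 0 ≤ lyapunov A col X s y k := fun k => edgeSum_nonneg fun _ _ _ => by positivity
  have hnr : ∀ k, 0 ≤ edgeSum A col (fun l i j => (X (k + 1) i l - X k j l) ^ 2) := fun k =>
    edgeSum_nonneg fun _ _ _ => by positivity
  have hanti : Antitone (lyapunov A col X s y) := antitone_nat_of_succ_le fun k => by
    linarith [hdec k, hnr k]
  have hlim := tendsto_atTop_ciInf hanti ⟨0, by rintro _ ⟨k, rfl⟩; exact hnn k⟩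
  have hdiff := hlim.sub (hlim.comp (tendsto_add_atTop_nat 1))
  rw [sub_self] at hdiff
  have hsq : Tendsto (fun k => (X (k + 1) i l - X k j l) ^ 2) atTop (𝓝 0) := by
    refine squeeze_zero (fun k => sq_nonneg _) (fun k => ?_) hdiff
    have := le_edgeSum (A := A) (col := col) (φ := fun l i j => (X (k + 1) i l - X k j l) ^ 2)
      (fun _ _ _ => sq_nonneg _) hA hc
    simp only [Function.comp_apply] at this ⊢
    linarith [hdec k]
  have := hsq.sqrt
  simp only [Real.sqrt_sq_eq_abs, Real.sqrt_zero] at this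
  exact (tendsto_zero_iff_abs_tendsto_zero _).2 this

end EdgeEnergy

/-! ### Boundedness, asymptotic regularity and cluster points. -/

section EdgeEnergyLimit

open scoped Classical
open Asymptotics

/-- The increment of `i` one iteration later differs from that of `j` by two consecutive steps `X (k
+ 1) i l - X k j l`, which vanish in the limit. -/
theorem tendsto_diff_iff_of_step {V L : Type*} {X : ℕ → V → L → ℝ} {l : L} {i j : V}
    (h : Tendsto (fun k => X (k + 1) i l - X k j l) atTop (𝓝 0)) :
    Tendsto (fun k => X (k + 1) i l - X k i l) atTop (𝓝 0) ↔
      Tendsto (fun k => X (k + 1) j l - X k j l) atTop (𝓝 0) := by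
  have h1 := (h.comp (tendsto_add_atTop_nat 1)).sub h
  rw [sub_zero] at h1
  rw [← tendsto_add_atTop_iff_nat (f := fun k => X (k + 1) i l - X k i l) 1]
  constructor
  · intro h2
    refine (sub_zero (0 : ℝ) ▸ h2.sub h1).congr fun k => ?_
    simp only [Function.comp_apply]
    ring
  · intro h2
    refine (add_zero (0 : ℝ) ▸ h2.add h1).congr fun k => ?_
    simp only [Function.comp_apply]
    ring

theorem exists_bound_of_sq_sub_le {u : ℕ → ℝ} {c M : ℝ} (h : ∀ k, (u k - c) ^ 2 ≤ M) :
    ∃ B, ∀ k, |u k| ≤ B := by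
  refine ⟨Real.sqrt M + |c|, fun k => ?_⟩
  have h1 := Real.abs_le_sqrt (h k)
  have h2 := abs_add_le (u k - c) c
  rw [sub_add_cancel] at h2
  linarith

theorem isBigO_one_of_bound {u : ℕ → ℝ} (h : ∃ B, ∀ k, |u k| ≤ B) :
    u =O[atTop] (fun _ => (1 : ℝ)) := by
  obtain ⟨B, hB⟩ := h
  exact IsBigO.of_bound B (Eventually.of_forall fun k => by simpa using hB k)

theorem tendsto_mul_zero_of_isBigO {u v : ℕ → ℝ} (hu : u =O[atTop] (fun _ => (1 : ℝ)))
    (hv : Tendsto v atTop (𝓝 0)) : Tendsto (fun k => u k * v k) atTop (𝓝 0) := by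
  have h := hu.mul_isLittleO ((isLittleO_one_iff ℝ).2 hv)
  simp only [mul_one] at h
  exact (isLittleO_one_iff ℝ).1 h

theorem isBigO_nodeGrad {V L κ : Type*} [Fintype V] [LinearOrder κ] {A : L → V → V → Prop}
    {col : V → κ} {X : ℕ → V → L → ℝ}
    (hdual : ∀ l i j, ∃ B, ∀ k, |edgeDual A X k l i j| ≤ B)
    (hprimal : ∀ p l, ∃ B, ∀ k, |X k p l| ≤ B) (p : V) (l : L) :
    (fun k => nodeGrad A col X k p l) =O[atTop] (fun _ => (1 : ℝ)) := by
  have hX : ∀ p l, (fun k => X k p l) =O[atTop] (fun _ => (1 : ℝ)) := fun p l =>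
    isBigO_one_of_bound (hprimal p l)
  have hX' : ∀ p l, (fun k => X (k + 1) p l) =O[atTop] (fun _ => (1 : ℝ)) := fun p l =>
    (hX p l).comp_tendsto (tendsto_add_atTop_nat 1)
  have h : (fun k => nodeGrad A col X k p l) = ∑ j with A l p j, fun k => edgeDual A X k l p j +
      (X (k + 1) p l - if col j < col p then X (k + 1) j l else X k j l) := by
    ext k
    simp only [nodeGrad, Finset.sum_apply]
  rw [h]
  refine IsBigO.sum fun j _ => (isBigO_one_of_bound (hdual l p j)).add ((hX' p l).sub ?_)
  by_cases h : col j < col p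
  · simpa only [h, if_true] using hX' j l
  · simpa only [h, if_false] using hX j l

variable {V L κ : Type*} [Fintype V] [Fintype L] [LinearOrder κ]
  {A : L → V → V → Prop} {col : V → κ} {X : ℕ → V → L → ℝ}

theorem lyapunov_le_zero {s : L → V → V → ℝ} {y : L → ℝ}
    (hdec : ∀ k, lyapunov A col X s y (k + 1)
      + edgeSum A col (fun l i j => (X (k + 1) i l - X k j l) ^ 2) ≤ lyapunov A col X s y k)
    (k : ℕ) : lyapunov A col X s y k ≤ lyapunov A col X s y 0 :=
  antitone_nat_of_succ_le (fun k => by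
    have : 0 ≤ edgeSum A col (fun l i j => (X (k + 1) i l - X k j l) ^ 2) :=
      edgeSum_nonneg fun _ _ _ => by positivity
    linarith [hdec k]) (Nat.zero_le k)

theorem exists_bound_upper {s : L → V → V → ℝ} {y : L → ℝ}
    (hdec : ∀ k, lyapunov A col X s y (k + 1)
      + edgeSum A col (fun l i j => (X (k + 1) i l - X k j l) ^ 2) ≤ lyapunov A col X s y k)
    {l : L} {i j : V} (hA : A l i j) (hc : col i < col j) :
    (∃ B, ∀ k, |edgeDual A X k l i j| ≤ B) ∧ ∃ B, ∀ k, |X k j l| ≤ B := by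
  have h : ∀ k, (edgeDual A X k l i j - s l i j) ^ 2 + (X k j l - y l) ^ 2 ≤
      lyapunov A col X s y 0 := fun k =>
    (le_edgeSum (φ := fun l i j => (edgeDual A X k l i j - s l i j) ^ 2 + (X k j l - y l) ^ 2)
      (fun _ _ _ => by positivity) hA hc).trans (lyapunov_le_zero hdec k)
  exact ⟨exists_bound_of_sq_sub_le fun k => (le_add_of_nonneg_right (sq_nonneg _)).trans (h k),
    exists_bound_of_sq_sub_le fun k => (le_add_of_nonneg_left (sq_nonneg _)).trans (h k)⟩

theorem exists_bound_dual (hsymm : ∀ l i j, A l i j → A l j i)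
    (hcol : ∀ l i j, A l i j → col i ≠ col j) {s : L → V → V → ℝ} {y : L → ℝ}
    (hdec : ∀ k, lyapunov A col X s y (k + 1)
      + edgeSum A col (fun l i j => (X (k + 1) i l - X k j l) ^ 2) ≤ lyapunov A col X s y k)
    (l : L) (i j : V) : ∃ B, ∀ k, |edgeDual A X k l i j| ≤ B := by
  by_cases hA : A l i j
  · rcases lt_or_gt_of_ne (hcol l i j hA) with h | h
    · exact (exists_bound_upper hdec hA h).1
    · obtain ⟨B, hB⟩ := (exists_bound_upper hdec (hsymm l i j hA) h).1
      exact ⟨B, fun k => by rw [edgeDual_swap hsymm, abs_neg]; exact hB k⟩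
  · exact ⟨0, fun k => by simp [edgeDual, hA]⟩

theorem exists_bound_primal (hsymm : ∀ l i j, A l i j → A l j i)
    (hcol : ∀ l i j, A l i j → col i ≠ col j) {s : L → V → V → ℝ} {y : L → ℝ}
    (hdec : ∀ k, lyapunov A col X s y (k + 1)
      + edgeSum A col (fun l i j => (X (k + 1) i l - X k j l) ^ 2) ≤ lyapunov A col X s y k)
    (hX : ∀ k p l, (¬∃ j, A l p j) → X k p l = 0) (p : V) (l : L) :
    ∃ B, ∀ k, |X k p l| ≤ B := by
  by_cases hA : ∃ j, A l p j
  · obtain ⟨j, hA⟩ := hA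
    rcases lt_or_gt_of_ne (hcol l p j hA) with h | h
    · obtain ⟨B, hB⟩ := (exists_bound_upper hdec hA h).2
      obtain ⟨B', hB'⟩ := (tendsto_step_of_lyapunov hdec hA h).isBoundedUnder_le.bddAbove_range
      obtain ⟨B'', hB''⟩ := (tendsto_step_of_lyapunov hdec hA h).isBoundedUnder_ge.bddBelow_range
      -- The energy controls only upper endpoints; a lower endpoint at time `k + 1` is close to its
      -- upper neighbour at time `k`, which leaves time `0` to be bounded separately.
      refine ⟨max (|X 0 p l|) (B + max B' (-B'')), fun k => ?_⟩
      cases k with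
      | zero => exact le_max_left _ _
      | succ k =>
        refine le_trans ?_ (le_max_right _ _)
        have h1 : X (k + 1) p l - X k j l ≤ B' := hB' ⟨k, rfl⟩
        have h2 : B'' ≤ X (k + 1) p l - X k j l := hB'' ⟨k, rfl⟩
        have h3 := abs_le.1 (hB k)
        have h4 := le_max_left B' (-B'')
        have h5 := le_max_right B' (-B'')
        rw [abs_le]
        constructor <;> linarith
    · exact (exists_bound_upper hdec (hsymm l p j hA) h).2
  · exact ⟨0, fun k => by simp [hX k p l hA]⟩

/-- The induction runs from the highest color down. A component with a higher neighbour inherits the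
claim; monotonicity of the subgradients of `f_p` gives the others. -/
theorem tendsto_diff_zero [WellFoundedGT κ] (hsymm : ∀ l i j, A l i j → A l j i)
    (hcol : ∀ l i j, A l i j → col i ≠ col j)
    (hdual : ∀ l i j, ∃ B, ∀ k, |edgeDual A X k l i j| ≤ B)
    (hprimal : ∀ p l, ∃ B, ∀ k, |X k p l| ≤ B)
    (hstep : ∀ l i j, A l i j → col i < col j →
      Tendsto (fun k => X (k + 1) i l - X k j l) atTop (𝓝 0))
    (hmono : ∀ k p, ∑ l, (nodeGrad A col X (k + 1) p l - nodeGrad A col X k p l)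
      * (X (k + 2) p l - X (k + 1) p l) ≤ 0) :
    ∀ p l j, A l p j → Tendsto (fun k => X (k + 1) p l - X k p l) atTop (𝓝 0) := by
  suffices ∀ c p, col p = c → ∀ l j, A l p j →
      Tendsto (fun k => X (k + 1) p l - X k p l) atTop (𝓝 0) from fun p => this _ p rfl
  intro c
  induction c using WellFoundedGT.induction with
  | ind c ih =>
  rintro p rfl l₀ j₀ hA₀
  by_cases hU₀ : ∃ j, A l₀ p j ∧ col p < col j
  · obtain ⟨j, hA, hc⟩ := hU₀
    exact (tendsto_diff_iff_of_step (hstep l₀ p j hA hc)).2 (ih _ hc j rfl l₀ p (hsymm _ _ _ hA))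
  set δ : ℕ → L → ℝ := fun k l => X (k + 2) p l - X (k + 1) p l with hδ
  have hδO : ∀ l, (fun k => δ k l) =O[atTop] (fun _ => (1 : ℝ)) := fun l =>
    ((isBigO_one_of_bound (hprimal p l)).comp_tendsto (tendsto_add_atTop_nat 2)).sub
      ((isBigO_one_of_bound (hprimal p l)).comp_tendsto (tendsto_add_atTop_nat 1))
  -- Main part of the monotonicity product. With a higher neighbour the product itself vanishes, as
  -- a bounded factor times an increment tending to zero. Otherwise all neighbours are lower, and
  -- the change of `nodeGrad` is the sum over them of `δ k l` minus a vanishing step.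
  set Q : ℕ → L → ℝ := fun k l => if ∃ j, A l p j ∧ col p < col j then 0 else
    ∑ j with A l p j, δ k l ^ 2 with hQ
  have hQnn : ∀ k l, 0 ≤ Q k l := by
    intro k l
    simp only [hQ]
    split_ifs
    · exact le_rfl
    · exact Finset.sum_nonneg fun _ _ => sq_nonneg _
  have herr : ∀ l, Tendsto (fun k => (nodeGrad A col X (k + 1) p l - nodeGrad A col X k p l)
      * δ k l - Q k l) atTop (𝓝 0) := by
    intro l
    by_cases hU : ∃ j, A l p j ∧ col p < col j
    · simp only [hQ, hU, if_true, sub_zero]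
      obtain ⟨j, hA, hc⟩ := hU
      have h1 := (tendsto_diff_iff_of_step (hstep l p j hA hc)).2
        (ih _ hc j rfl l p (hsymm _ _ _ hA))
      have hO := isBigO_nodeGrad (col := col) hdual hprimal p l
      exact tendsto_mul_zero_of_isBigO ((hO.comp_tendsto (tendsto_add_atTop_nat 1)).sub hO)
        (h1.comp (tendsto_add_atTop_nat 1))
    · simp only [hQ, hU, if_false]
      have hlow : ∀ j, A l p j → col j < col p := fun j hA =>
        lt_of_le_of_ne (not_lt.1 fun h => hU ⟨j, hA, h⟩) (hcol l p j hA).symm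
      have hlim : Tendsto (fun k => ∑ j with A l p j, δ k l * -(X (k + 2) j l - X (k + 1) p l))
          atTop (𝓝 (∑ j with A l p j, (0 : ℝ))) := by
        refine tendsto_finsetSum _ fun j hj => ?_
        have hA := (Finset.mem_filter.1 hj).2
        refine tendsto_mul_zero_of_isBigO (hδO l) ?_
        simpa using ((hstep l j p (hsymm _ _ _ hA) (hlow j hA)).comp
          (tendsto_add_atTop_nat 1)).neg
      rw [Finset.sum_const_zero] at hlim
      refine hlim.congr fun k => ?_
      rw [nodeGrad, nodeGrad, ← Finset.sum_sub_distrib, Finset.sum_mul, ← Finset.sum_sub_distrib]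
      refine Finset.sum_congr rfl fun j hj => ?_
      have hA := (Finset.mem_filter.1 hj).2
      rw [if_pos (hlow j hA), if_pos (hlow j hA), edgeDual_succ hA]
      simp only [hδ]
      ring
  have hsum := (tendsto_finsetSum Finset.univ fun l _ => herr l).neg
  rw [Finset.sum_const_zero, neg_zero] at hsum
  have hsq : Tendsto (fun k => δ k l₀ ^ 2) atTop (𝓝 0) := by
    refine squeeze_zero (fun k => sq_nonneg _) (fun k => ?_) hsum
    have h1 : δ k l₀ ^ 2 ≤ Q k l₀ := by
      simp only [hQ, hU₀, if_false]
      exact Finset.single_le_sum (f := fun _ => δ k l₀ ^ 2) (fun _ _ => sq_nonneg _)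
        (Finset.mem_filter.2 ⟨Finset.mem_univ j₀, hA₀⟩)
    have h2 : Q k l₀ ≤ ∑ l, Q k l :=
      Finset.single_le_sum (fun l _ => hQnn k l) (Finset.mem_univ l₀)
    have h3 := hmono k p
    rw [Finset.sum_sub_distrib]
    linarith
  have := hsq.sqrt
  simp only [Real.sqrt_sq_eq_abs, Real.sqrt_zero] at this
  exact (tendsto_add_atTop_iff_nat (f := fun k => X (k + 1) p l₀ - X k p l₀) 1).1
    ((tendsto_zero_iff_abs_tendsto_zero _).2 this)

theorem exists_cluster (hdual : ∀ l i j, ∃ B, ∀ k, |edgeDual A X k l i j| ≤ B)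
    (hprimal : ∀ p l, ∃ B, ∀ k, |X k p l| ≤ B) :
    ∃ (Z : V → L → ℝ) (s : L → V → V → ℝ) (φ : ℕ → ℕ), StrictMono φ ∧
      (∀ p l, Tendsto (fun k => X (φ k) p l) atTop (𝓝 (Z p l))) ∧
      ∀ l i j, Tendsto (fun k => edgeDual A X (φ k) l i j) atTop (𝓝 (s l i j)) := by
  choose B hB using hdual
  choose B' hB' using hprimal
  have hc : IsCompact ((Set.univ.pi fun p => Set.univ.pi fun l => Set.Icc (-B' p l) (B' p l)) ×ˢ
      (Set.univ.pi fun l => Set.univ.pi fun i => Set.univ.pi fun j =>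
        Set.Icc (-B l i j) (B l i j))) :=
    (isCompact_univ_pi fun p => isCompact_univ_pi fun l => isCompact_Icc).prod
      (isCompact_univ_pi fun l => isCompact_univ_pi fun i => isCompact_univ_pi fun j =>
        isCompact_Icc)
  obtain ⟨⟨Z, s⟩, -, φ, hφ, hlim⟩ := hc.tendsto_subseq (x := fun k => (X k, edgeDual A X k))
    fun k => ⟨fun p _ l _ => abs_le.1 (hB' p l k), fun l _ i _ j _ => abs_le.1 (hB l i j k)⟩
  have h1 := hlim.fst_nhds
  have h2 := hlim.snd_nhds
  refine ⟨Z, s, φ, hφ, fun p l => ?_, fun l i j => ?_⟩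
  · exact tendsto_pi_nhds.1 (tendsto_pi_nhds.1 h1 p) l
  · exact tendsto_pi_nhds.1 (tendsto_pi_nhds.1 (tendsto_pi_nhds.1 h2 l) i) j

/-- Fejér monotonicity: a decreasing energy that tends to zero along a subsequence tends to zero. It
controls upper endpoints directly, and lower ones through the vanishing steps. -/
theorem tendsto_of_lyapunov_subseq (hsymm : ∀ l i j, A l i j → A l j i)
    (hcol : ∀ l i j, A l i j → col i ≠ col j) {s : L → V → V → ℝ} {y : L → ℝ}
    (hdec : ∀ k, lyapunov A col X s y (k + 1)
      + edgeSum A col (fun l i j => (X (k + 1) i l - X k j l) ^ 2) ≤ lyapunov A col X s y k)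
    {φ : ℕ → ℕ} (hφ : StrictMono φ)
    (hX : ∀ p l, (∃ j, A l p j) → Tendsto (fun k => X (φ k) p l) atTop (𝓝 (y l)))
    (hd : ∀ l i j, A l i j → Tendsto (fun k => edgeDual A X (φ k) l i j) atTop (𝓝 (s l i j)))
    {p : V} {l : L} (hp : ∃ j, A l p j) : Tendsto (fun k => X k p l) atTop (𝓝 (y l)) := by
  have hanti : Antitone (lyapunov A col X s y) := antitone_nat_of_succ_le fun k => by
    have : 0 ≤ edgeSum A col (fun l i j => (X (k + 1) i l - X k j l) ^ 2) :=
      edgeSum_nonneg fun _ _ _ => by positivity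
    linarith [hdec k]
  have hsub : Tendsto (lyapunov A col X s y ∘ φ) atTop (𝓝 0) := by
    have h : Tendsto (lyapunov A col X s y ∘ φ) atTop
        (𝓝 (edgeSum A col fun l i j => (s l i j - s l i j) ^ 2 + (y l - y l) ^ 2)) :=
      tendsto_edgeSum fun l i j hA _ => (((hd l i j hA).sub_const _).pow 2).add
        (((hX j l ⟨i, hsymm _ _ _ hA⟩).sub_const _).pow 2)
    simpa [edgeSum] using h
  have hlim : Tendsto (lyapunov A col X s y) atTop (𝓝 0) :=
    (tendsto_iff_tendsto_subseq_of_antitone hanti hφ.tendsto_atTop).2 hsub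
  have hupper : ∀ {l i j}, A l i j → col i < col j →
      Tendsto (fun k => X k j l) atTop (𝓝 (y l)) := by
    intro l i j hA hc
    have hsq : Tendsto (fun k => (X k j l - y l) ^ 2) atTop (𝓝 0) :=
      squeeze_zero (fun k => sq_nonneg _) (fun k =>
        (le_add_of_nonneg_left (sq_nonneg _)).trans (le_edgeSum (A := A) (col := col)
          (φ := fun l i j => (edgeDual A X k l i j - s l i j) ^ 2 + (X k j l - y l) ^ 2)
          (fun _ _ _ => by positivity) hA hc)) hlim
    have := hsq.sqrt
    simp only [Real.sqrt_sq_eq_abs, Real.sqrt_zero] at this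
    exact tendsto_sub_nhds_zero_iff.1 ((tendsto_zero_iff_abs_tendsto_zero _).2 this)
  obtain ⟨j, hA⟩ := hp
  rcases lt_or_gt_of_ne (hcol l p j hA) with h | h
  · have h1 := (tendsto_step_of_lyapunov hdec hA h).add (hupper hA h)
    rw [zero_add] at h1
    refine (tendsto_add_atTop_iff_nat (f := fun k => X k p l) 1).1 (h1.congr fun k => ?_)
    ring
  · exact hupper (hsymm _ _ _ hA) h

/-- The cluster points of the multipliers and estimates are dual variables together with a
consensus value, and they determine the limit of the node gradients. -/
theorem exists_consensus_cluster [WellFoundedGT κ] (hsymm : ∀ l i j, A l i j → A l j i)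
    (hcol : ∀ l i j, A l i j → col i ≠ col j)
    (hconn : ∀ l p q, (∃ j, A l p j) → (∃ j, A l q j) → Relation.ReflTransGen (A l) p q)
    (hedge : ∀ l, ∃ i j, A l i j)
    (hX : ∀ k p l, (¬∃ j, A l p j) → X k p l = 0)
    {s₀ : L → V → V → ℝ} {y₀ : L → ℝ}
    (hdec : ∀ k, lyapunov A col X s₀ y₀ (k + 1)
      + edgeSum A col (fun l i j => (X (k + 1) i l - X k j l) ^ 2) ≤ lyapunov A col X s₀ y₀ k)
    (hmono : ∀ k p, ∑ l, (nodeGrad A col X (k + 1) p l - nodeGrad A col X k p l)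
      * (X (k + 2) p l - X (k + 1) p l) ≤ 0) :
    ∃ (y : L → ℝ) (s : L → V → V → ℝ) (φ : ℕ → ℕ), StrictMono φ ∧
      (∀ l i j, s l j i = -s l i j) ∧
      (∀ p l, (∃ j, A l p j) → Tendsto (fun k => X (φ k) p l) atTop (𝓝 (y l))) ∧
      (∀ p l, (∃ j, A l p j) → Tendsto (fun k => X (φ k + 1) p l) atTop (𝓝 (y l))) ∧
      (∀ l i j, Tendsto (fun k => edgeDual A X (φ k) l i j) atTop (𝓝 (s l i j))) ∧
      ∀ p l, Tendsto (fun k => nodeGrad A col X (φ k) p l) atTop (𝓝 (∑ j with A l p j, s l p j)) := by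
  have hdual := exists_bound_dual hsymm hcol hdec
  have hprimal := exists_bound_primal hsymm hcol hdec hX
  have hstep := fun l i j (hA : A l i j) (hc : col i < col j) =>
    tendsto_step_of_lyapunov hdec hA hc
  have hdiff := tendsto_diff_zero hsymm hcol hdual hprimal hstep hmono
  obtain ⟨Z, s, φ, hφ, hZ, hs⟩ := exists_cluster hdual hprimal
  have hZ' : ∀ p l, (∃ j, A l p j) → Tendsto (fun k => X (φ k + 1) p l) atTop (𝓝 (Z p l)) := by
    rintro p l ⟨j, hA⟩
    have h := ((hdiff p l j hA).comp hφ.tendsto_atTop).add (hZ p l)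
    rw [zero_add] at h
    refine h.congr fun k => ?_
    simp only [Function.comp_apply]
    ring
  have hlt : ∀ l i j, A l i j → col i < col j → Z i l = Z j l := by
    intro l i j hA hc
    have h1 := (hZ' i l ⟨j, hA⟩).sub (hZ j l)
    exact sub_eq_zero.1 (tendsto_nhds_unique h1 ((hstep l i j hA hc).comp hφ.tendsto_atTop))
  have heq : ∀ l i j, A l i j → Z i l = Z j l := by
    intro l i j hA
    rcases lt_or_gt_of_ne (hcol l i j hA) with h | h
    · exact hlt l i j hA h
    · exact (hlt l j i (hsymm _ _ _ hA) h).symm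
  have htrans : ∀ l p q, Relation.ReflTransGen (A l) p q → Z p l = Z q l := by
    intro l p q h
    induction h with
    | refl => rfl
    | tail _ h ih => exact ih.trans (heq l _ _ h)
  choose a b hab using hedge
  have hy : ∀ p l, (∃ j, A l p j) → Z p l = Z (a l) l := fun p l h =>
    htrans l _ _ (hconn l _ _ h ⟨_, hab l⟩)
  refine ⟨fun l => Z (a l) l, s, φ, hφ, fun l i j => ?_, fun p l h => ?_, fun p l h => ?_,
    hs, fun p l => ?_⟩
  · refine tendsto_nhds_unique (hs l j i) ((hs l i j).neg.congr fun k => ?_)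
    rw [edgeDual_swap hsymm X (φ k) l i j]
  · simpa only [← hy p l h] using hZ p l
  · simpa only [← hy p l h] using hZ' p l h
  · refine tendsto_finsetSum _ fun j hj => ?_
    have hA := (Finset.mem_filter.1 hj).2
    have hj' : ∃ i, A l j i := ⟨p, hsymm _ _ _ hA⟩
    have h1 : Tendsto (fun k => if col j < col p then X (φ k + 1) j l else X (φ k) j l) atTop
        (𝓝 (Z p l)) := by
      rw [heq l p j hA]
      split_ifs
      · exact hZ' j l hj'
      · exact hZ j l
    simpa using (hs l p j).add ((hZ' p l ⟨j, hA⟩).sub h1)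

end EdgeEnergyLimit

/-! ### Translation of the network problem to the edge formulation. -/

section Network

open scoped Classical

variable {V : Type*} {n C : ℕ}

/-- `(i, j)` is an edge of the subgraph induced by the component `l`. -/
def Linked (G : SimpleGraph V) (S : V → Finset (Fin n)) (l : Fin n) (i j : V) : Prop :=
  G.Adj i j ∧ l ∈ S i ∧ l ∈ S j

variable {G : SimpleGraph V} {S : V → Finset (Fin n)}

theorem Linked.symm (l : Fin n) (i j : V) (h : Linked G S l i j) : Linked G S l j i :=
  ⟨h.1.symm, h.2.2, h.2.1⟩

theorem Linked.col_ne (col : G.Coloring (Fin C)) (l : Fin n) (i j : V) (h : Linked G S l i j) :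
    col i ≠ col j :=
  col.valid h.1

theorem exists_linked (hconn : IsConnectedVariable G S)
    (hshared : ∀ l, ∃ p q, p ≠ q ∧ l ∈ S p ∧ l ∈ S q) {p : V} {l : Fin n} (hl : l ∈ S p) :
    ∃ j, Linked G S l p j := by
  obtain ⟨a, b, hab, ha, hb⟩ := hshared l
  have : Nontrivial {p : V // l ∈ S p} := ⟨⟨a, ha⟩, ⟨b, hb⟩, fun h => hab (Subtype.ext_iff.1 h)⟩
  obtain ⟨j, hj⟩ := (hconn l).preconnected.exists_adj_of_nontrivial ⟨p, hl⟩
  exact ⟨j.1, hj, hl, j.2⟩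

theorem reflTransGen_linked (hconn : IsConnectedVariable G S) {l : Fin n} {p q : V}
    (hp : l ∈ S p) (hq : l ∈ S q) : Relation.ReflTransGen (Linked G S l) p q := by
  have h := (SimpleGraph.reachable_iff_reflTransGen _ _).1
    ((hconn l).preconnected ⟨p, hp⟩ ⟨q, hq⟩)
  exact h.lift Subtype.val fun a b hab => ⟨hab, a.2, b.2⟩

theorem entry_of_mem {z : Copies S} {p : V} {l : Fin n} (h : l ∈ S p) :
    entry z p l = z p ⟨l, h⟩ :=
  dif_pos h

theorem entry_of_notMem {z : Copies S} {p : V} {l : Fin n} (h : l ∉ S p) : entry z p l = 0 :=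
  dif_neg h

theorem entry_coe (z : Copies S) (p : V) (l : S p) : entry z p l = z p l :=
  entry_of_mem l.2

theorem entry_restrict {y : EuclideanSpace ℝ (Fin n)} {p : V} {l : Fin n} (h : l ∈ S p) :
    entry (restrict S y) p l = y l :=
  entry_of_mem h

theorem sum_coe_eq_sum {s : Finset (Fin n)} {φ : Fin n → ℝ} (h : ∀ l, l ∉ s → φ l = 0) :
    ∑ l : s, φ l = ∑ l, φ l := by
  rw [Finset.sum_coe_sort s φ]
  exact Finset.sum_subset (Finset.subset_univ s) fun l _ hl => h l hl

theorem tendsto_euclidean {ι : Type*} [Fintype ι] {u : ℕ → EuclideanSpace ℝ ι}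
    {u' : EuclideanSpace ℝ ι} (h : ∀ l, Tendsto (fun k => u k l) atTop (𝓝 (u' l))) :
    Tendsto u atTop (𝓝 u') :=
  ((PiLp.continuous_toLp 2 fun _ : ι => ℝ).tendsto u'.ofLp).comp
    (tendsto_pi_nhds.2 h : Tendsto (fun k => (u k).ofLp) atTop (𝓝 u'.ofLp))

/-- Monotonicity with the factor `-ρ` divided out, and extended by zero terms from `S p` to all
components. -/
theorem sum_mul_nonpos_of_isSubgradient {ρ : ℝ} (hρ : 0 < ρ)
    {f : ∀ p : V, EuclideanSpace ℝ (S p) → WithTop ℝ} {p : V} {u u' : Copies S}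
    {g g' : Fin n → ℝ} (h : IsSubgradient (f p) (u p) fun l : S p => -(ρ * g l))
    (h' : IsSubgradient (f p) (u' p) fun l : S p => -(ρ * g' l)) (hg : ∀ l, l ∉ S p → g l = g' l) :
    ∑ l, (g l - g' l) * (entry u p l - entry u' p l) ≤ 0 := by
  have h1 := h.monotone h'
  rw [← sum_coe_eq_sum (s := S p) fun l hl => by rw [hg l hl]; ring]
  refine nonpos_of_mul_nonpos_right ?_ hρ
  rw [Finset.mul_sum, ← neg_nonneg, ← Finset.sum_neg_distrib]
  refine h1.trans_eq (Finset.sum_congr rfl fun l _ => ?_)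
  rw [entry_coe, entry_coe]
  ring

variable [Fintype V]

theorem nbrs_eq_filter {p : V} {l : Fin n} (h : l ∈ S p) :
    nbrs G S p l = Finset.univ.filter (Linked G S l p) := by
  ext j
  simp [nbrs, Linked, h]

theorem one_le_deg (hconn : IsConnectedVariable G S)
    (hshared : ∀ l, ∃ p q, p ≠ q ∧ l ∈ S p ∧ l ∈ S q) (p : V) (l : S p) :
    (1 : ℝ) ≤ (deg G S p l : ℝ) := by
  obtain ⟨j, hj⟩ := exists_linked hconn hshared l.2
  have : 0 < deg G S p l := Finset.card_pos.2 ⟨j, by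
    rw [nbrs_eq_filter l.2]
    exact Finset.mem_filter.2 ⟨Finset.mem_univ j, hj⟩⟩
  exact_mod_cast this

/-! ### Existence and uniqueness of sweeps and runs. -/

variable {f : ∀ p : V, EuclideanSpace ℝ (S p) → WithTop ℝ} {col : G.Coloring (Fin C)} {ρ : ℝ}

/-- `xNew` is obtained from `xOld` and `γ` by one sweep of local minimizations over the colors. -/
def IsSweep (f : ∀ p : V, EuclideanSpace ℝ (S p) → WithTop ℝ) (col : G.Coloring (Fin C)) (ρ : ℝ)
    (γ xOld xNew : Copies S) (p : V) : Prop :=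
  IsMinOn (fun u : EuclideanSpace ℝ (S p) => f p u + (localQuad (vStep G S col ρ γ xOld xNew p)
    (fun l : S p => (deg G S p l : ℝ)) ρ u : WithTop ℝ)) Set.univ (xNew p)

theorem vStep_congr {γ xOld y z : Copies S} {p : V} (h : ∀ j, col j < col p → y j = z j) :
    vStep G S col ρ γ xOld y p = vStep G S col ρ γ xOld z p := by
  ext l
  unfold vStep
  congr 3
  refine Finset.sum_congr rfl fun j hj => ?_
  rw [entry, entry, h j (Finset.mem_filter.1 hj).2]

/-- The local problems form a triangular system: each depends on the new iterate only through
strictly smaller colors, so they are solved color by color. -/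
theorem exists_sweep (hf : ∀ p, IsClosedConvexProper (f p))
    (hsub : ∀ p, ∃ u q, IsSubgradient (f p) u q) (hρ : 0 < ρ)
    (hdeg : ∀ p (l : S p), (1 : ℝ) ≤ (deg G S p l : ℝ)) (γ xOld : Copies S) :
    ∃ xNew, ∀ p, IsSweep f col ρ γ xOld xNew p := by
  suffices ∀ m : ℕ, ∃ y : Copies S, ∀ p, (col p : ℕ) < m → IsSweep f col ρ γ xOld y p by
    obtain ⟨y, hy⟩ := this C
    exact ⟨y, fun p => hy p (col p).2⟩
  intro m
  induction m with
  | zero => exact ⟨0, fun p h => absurd h (Nat.not_lt_zero _)⟩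
  | succ m ih =>
    obtain ⟨y, hy⟩ := ih
    have hex : ∀ p, ∃ w, IsMinOn (fun u : EuclideanSpace ℝ (S p) => f p u +
        (localQuad (vStep G S col ρ γ xOld y p) (fun l : S p => (deg G S p l : ℝ)) ρ u :
          WithTop ℝ)) Set.univ w := fun p => by
      obtain ⟨u, q, hq⟩ := hsub p
      exact exists_isMinOn_add_localQuad (hf p).closed hq hρ (hdeg p)
    choose w hw using hex
    refine ⟨fun p => if (col p : ℕ) = m then w p else y p, fun p hp => ?_⟩
    have hv : vStep G S col ρ γ xOld (fun p => if (col p : ℕ) = m then w p else y p) p =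
        vStep G S col ρ γ xOld y p := vStep_congr fun j hj => by
      have h1 : (col j : ℕ) < col p := hj
      exact if_neg (by omega)
    unfold IsSweep
    rw [hv]
    by_cases h : (col p : ℕ) = m
    · simpa only [h, if_true] using hw p
    · have hyp := hy p (by omega)
      unfold IsSweep at hyp
      simpa only [h, if_false] using hyp

/-- Once lower colors agree, two minimizers solve the same problem; monotonicity of `f p` against
the quadratic term with degrees at least one forces them to coincide. -/
theorem IsSweep.unique (hf : ∀ p, IsClosedConvexProper (f p)) (hρ : 0 < ρ)
    (hdeg : ∀ p (l : S p), (1 : ℝ) ≤ (deg G S p l : ℝ)) {γ xOld y z : Copies S}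
    (hy : ∀ p, IsSweep f col ρ γ xOld y p) (hz : ∀ p, IsSweep f col ρ γ xOld z p) : y = z := by
  suffices ∀ c p, col p = c → y p = z p from funext fun p => this _ p rfl
  intro c
  induction c using WellFoundedLT.induction with
  | ind c ih =>
  rintro p rfl
  have h1 := hy p
  have h2 := hz p
  rw [IsSweep, vStep_congr fun j hj => ih _ hj j rfl] at h1
  have h := (isSubgradient_of_isMinOn (hf p) h1).monotone (isSubgradient_of_isMinOn (hf p) h2)
  have h3 : ∑ l : S p, (y p l - z p l) ^ 2 ≤ 0 := by
    have h4 : ρ * ∑ l : S p, (deg G S p l : ℝ) * (y p l - z p l) ^ 2 ≤ 0 := by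
      rw [Finset.mul_sum, ← neg_nonneg, ← Finset.sum_neg_distrib]
      refine h.trans_eq (Finset.sum_congr rfl fun l _ => ?_)
      ring
    have h5 : ∑ l : S p, (y p l - z p l) ^ 2 ≤
        ∑ l : S p, (deg G S p l : ℝ) * (y p l - z p l) ^ 2 :=
      Finset.sum_le_sum fun l _ => le_mul_of_one_le_left (sq_nonneg _) (hdeg p l)
    exact h5.trans (nonpos_of_mul_nonpos_right h4 hρ)
  have h6 := (Finset.sum_eq_zero_iff_of_nonneg fun l _ => sq_nonneg _).1
    (le_antisymm h3 (Finset.sum_nonneg fun l _ => sq_nonneg _))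
  ext l
  exact sub_eq_zero.1 (pow_eq_zero_iff two_ne_zero |>.1 (h6 l (Finset.mem_univ l)))

theorem IsRun.isSweep {x γ : ℕ → Copies S} (h : IsRun G S f col ρ x γ) (k : ℕ) (p : V) :
    IsSweep f col ρ (γ k) (x k) (x (k + 1)) p :=
  h.x_step k p

theorem IsRun.unique (hf : ∀ p, IsClosedConvexProper (f p)) (hρ : 0 < ρ)
    (hdeg : ∀ p (l : S p), (1 : ℝ) ≤ (deg G S p l : ℝ)) {x γ x' γ' : ℕ → Copies S}
    (h : IsRun G S f col ρ x γ) (h' : IsRun G S f col ρ x' γ') (k : ℕ) :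
    x k = x' k ∧ γ k = γ' k := by
  induction k with
  | zero =>
    exact ⟨funext fun p => (h.x_zero p).trans (h'.x_zero p).symm,
      funext fun p => (h.γ_zero p).trans (h'.γ_zero p).symm⟩
  | succ k ih =>
    have hx : x (k + 1) = x' (k + 1) := by
      refine IsSweep.unique hf hρ hdeg (h.isSweep k) ?_
      rw [ih.1, ih.2]
      exact h'.isSweep k
    refine ⟨hx, funext fun p => ?_⟩
    ext l
    rw [h.γ_step, h'.γ_step, hx, ih.2]

theorem exists_isRun (hf : ∀ p, IsClosedConvexProper (f p))
    (hsub : ∀ p, ∃ u q, IsSubgradient (f p) u q) (hρ : 0 < ρ)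
    (hdeg : ∀ p (l : S p), (1 : ℝ) ≤ (deg G S p l : ℝ)) :
    ∃ x γ : ℕ → Copies S, IsRun G S f col ρ x γ := by
  choose next hnext using fun s : Copies S × Copies S =>
    exists_sweep (col := col) hf hsub hρ hdeg s.2 s.1
  let state : ℕ → Copies S × Copies S := fun k => Nat.rec (0, 0) (fun _ s => (next s, fun p =>
    WithLp.toLp 2 fun l : S p => s.2 p l +
      ρ * ∑ j ∈ nbrs G S p l, (next s p l - entry (next s) j l))) k
  exact ⟨fun k => (state k).1, fun k => (state k).2, fun _ => rfl, fun _ => rfl,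
    fun k p => hnext (state k) p, fun _ _ _ => rfl⟩

theorem IsRun.γ_eq {x γ : ℕ → Copies S} (h : IsRun G S f col ρ x γ) (k : ℕ) (p : V) (l : S p) :
    γ k p l = ρ * ∑ j with Linked G S l p j,
      edgeDual (Linked G S) (fun k => entry (x k)) k l p j := by
  induction k with
  | zero => simp [h.γ_zero, edgeDual]
  | succ k ih =>
    rw [h.γ_step, ih, ← mul_add, nbrs_eq_filter l.2, ← Finset.sum_add_distrib]
    congr 1
    refine Finset.sum_congr rfl fun j hj => ?_
    rw [edgeDual_succ (Finset.mem_filter.1 hj).2, entry_coe]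

theorem IsRun.isSubgradient (hf : ∀ p, IsClosedConvexProper (f p)) {x γ : ℕ → Copies S}
    (h : IsRun G S f col ρ x γ) (k : ℕ) (p : V) :
    IsSubgradient (f p) (x (k + 1) p) fun l : S p =>
      -(ρ * nodeGrad (Linked G S) col (fun k => entry (x k)) k p l) := by
  convert isSubgradient_of_isMinOn (hf p) (h.isSweep k p) using 3 with l
  -- Adjacent nodes have different colors, so a neighbour that is not lower is higher, and the two
  -- filtered sums of `vStep` match the conditional in `nodeGrad`.
  rw [vStep, h.γ_eq, nodeGrad, deg, nbrs_eq_filter l.2, Finset.sum_add_distrib,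
    Finset.sum_sub_distrib, Finset.sum_const, Finset.sum_ite, Finset.filter_congr
      (p := fun j => ¬col j < col p) (q := fun j => col p < col j) fun j hj => by
        have := Linked.col_ne col _ _ _ (Finset.mem_filter.1 hj).2
        exact ⟨fun h => lt_of_le_of_ne (not_lt.1 h) this, fun h => h.not_gt⟩,
    nsmul_eq_mul, entry_coe]
  ring

/-! ### Saddle points, optimality and strong duality. -/

/-- The Lagrangian multipliers, up to the factor `ρ`, form a saddle point with `y`. -/
def IsSaddle (G : SimpleGraph V) (f : ∀ p : V, EuclideanSpace ℝ (S p) → WithTop ℝ) (ρ : ℝ)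
    (s : Fin n → V → V → ℝ) (y : EuclideanSpace ℝ (Fin n)) : Prop :=
  (∀ l i j, Linked G S l i j → s l j i = -s l i j) ∧
    ∀ p, IsSubgradient (f p) (restrict S y p) fun l : S p =>
      -(ρ * ∑ j with Linked G S l p j, s l p j)

theorem sum_linked_eq_zero {p : V} {l : Fin n} (h : l ∉ S p) (φ : V → ℝ) :
    ∑ j with Linked G S l p j, φ j = 0 :=
  Finset.sum_eq_zero fun _ hj => absurd (Finset.mem_filter.1 hj).2.2.1 h

/-- Summing the subgradient inequalities over the nodes, the linear terms cancel edge by edge,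
because the multipliers are antisymmetric and the compared points are consensual. -/
theorem IsSaddle.isSolution (col : G.Coloring (Fin C)) {s : Fin n → V → V → ℝ}
    {y : EuclideanSpace ℝ (Fin n)} (h : IsSaddle G f ρ s y) : IsSolution S f y := by
  obtain ⟨hs, hsub⟩ := h
  choose a ha hmin using hsub
  have hy : objective S f y = ((∑ p, a p : ℝ) : WithTop ℝ) := by
    rw [objective, WithTop.coe_sum]
    exact Finset.sum_congr rfl fun p _ => ha p
  refine ⟨by rw [hy]; exact WithTop.coe_ne_top, fun z => ?_⟩
  by_cases hz : objective S f z = ⊤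
  · rw [hz]
    exact le_top
  have hz' : ∀ p, ∃ b : ℝ, (b : WithTop ℝ) = f p (restrict S z p) := fun p =>
    WithTop.ne_top_iff_exists.1 fun htop =>
      hz (WithTop.sum_eq_top.2 ⟨p, Finset.mem_univ p, htop⟩)
  choose b hb using hz'
  have hzb : objective S f z = ((∑ p, b p : ℝ) : WithTop ℝ) := by
    rw [objective, WithTop.coe_sum]
    exact Finset.sum_congr rfl fun p _ => (hb p).symm
  rw [hy, hzb, WithTop.coe_le_coe]
  have h0 : ∑ p, ∑ l : S p, -(ρ * ∑ j with Linked G S l p j, s l p j) * (z l - y l) = 0 := by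
    have h1 : ∀ p, ∑ l : S p, -(ρ * ∑ j with Linked G S l p j, s l p j) * (z l - y l) =
        ∑ l, ∑ j with Linked G S l p j, -(ρ * s l p j) * (z l - y l) := by
      intro p
      rw [sum_coe_eq_sum (φ := fun l => -(ρ * ∑ j with Linked G S l p j, s l p j) * (z l - y l))
        fun l hl => by rw [sum_linked_eq_zero hl]; ring]
      refine Finset.sum_congr rfl fun l _ => ?_
      rw [Finset.mul_sum, ← Finset.sum_neg_distrib, Finset.sum_mul]
    rw [Finset.sum_congr rfl fun p _ => h1 p, sum_nbrs_eq_edgeSum Linked.symm (Linked.col_ne col)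
      fun l p j => -(ρ * s l p j) * (z l - y l)]
    refine (edgeSum_congr (ψ := fun _ _ _ => 0) fun l i j hA _ => ?_).trans (by simp [edgeSum])
    rw [hs l i j hA]
    ring
  have h1 := Finset.sum_le_sum fun p (_ : p ∈ Finset.univ) =>
    hmin p (restrict S z p) (b p) (hb p).ge
  rw [Finset.sum_add_distrib] at h1
  linarith [(show ∑ p, ∑ l : S p, -(ρ * ∑ j with Linked G S l p j, s l p j) *
    ((restrict S z p) l - (restrict S y p) l) = 0 from h0)]

theorem lagrangian_penalty_eq (lam : Fin n → V → V → ℝ) (z : Copies S) :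
    ∑ i, ∑ l ∈ S i, ∑ j ∈ nbrs G S i l with col i < col j,
      lam l i j * (entry z i l - entry z j l) =
    edgeSum (Linked G S) col fun l i j => lam l i j * (entry z i l - entry z j l) := by
  rw [edgeSum, Finset.sum_comm]
  refine Finset.sum_congr rfl fun i _ => ?_
  rw [← Finset.sum_subset (Finset.subset_univ (S i))]
  · refine Finset.sum_congr rfl fun l hl => ?_
    rw [nbrs_eq_filter hl, Finset.filter_filter]
  · intro l _ hl
    exact Finset.sum_eq_zero fun _ hj => absurd (Finset.mem_filter.1 hj).2.1.2.1 hl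

/-- The penalty is linear and vanishes at consensus, so perturbing the optimal copies at a single
node in the dual inequality isolates the subgradient inequality of that node. -/
theorem exists_isSaddle (hρ : 0 < ρ) (hsolv : ∃ x, IsSolution S f x)
    (hdual : StrongDuality G S f col) : ∃ s y, IsSaddle G f ρ s y := by
  obtain ⟨y, hy⟩ := hsolv
  obtain ⟨lam, hlam⟩ := hdual
  -- Antisymmetric extension of `lam`, which enters the Lagrangian only on edges oriented by
  -- increasing color.
  set σ : Fin n → V → V → ℝ := fun l i j => if col i < col j then lam l i j else -lam l j i with hσ
  refine ⟨fun l i j => σ l i j / ρ, y, fun l i j hA => ?_, fun p => ?_⟩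
  · rcases lt_or_gt_of_ne (Linked.col_ne col l i j hA) with h | h
    · simp [hσ, h, h.not_gt, neg_div]
    · simp [hσ, h, h.not_gt, neg_div]
  have hfin : ∀ q, ∃ a : ℝ, (a : WithTop ℝ) = f q (restrict S y q) := fun q =>
    WithTop.ne_top_iff_exists.1 fun htop =>
      hy.1 (WithTop.sum_eq_top.2 ⟨q, Finset.mem_univ q, htop⟩)
  choose a ha using hfin
  refine ⟨a p, (ha p).symm, fun w b hw => ?_⟩
  have hpen : ∀ z : Copies S, edgeSum (Linked G S) col
      (fun l i j => lam l i j * (entry z i l - entry z j l)) =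
      ∑ q, ∑ l, (∑ j with Linked G S l q j, σ l q j) * entry z q l := by
    intro z
    simp only [Finset.sum_mul]
    rw [sum_nbrs_eq_edgeSum Linked.symm (Linked.col_ne col) fun l q j => σ l q j * entry z q l]
    refine edgeSum_congr fun l i j _ hc => ?_
    simp only [hσ, hc, if_true, hc.not_gt, if_false]
    ring
  have hpen0 : ∑ q, ∑ l, (∑ j with Linked G S l q j, σ l q j) * entry (restrict S y) q l = 0 := by
    rw [← hpen]
    refine (edgeSum_congr (ψ := fun _ _ _ => 0) fun l i j hA _ => ?_).trans (by simp [edgeSum])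
    rw [entry_restrict hA.2.1, entry_restrict hA.2.2, sub_self, mul_zero]
  set z : Copies S := Function.update (restrict S y) p w with hz
  have hzp : z p = w := Function.update_self ..
  have hzq : ∀ q, q ≠ p → z q = restrict S y q := fun q hq => Function.update_of_ne hq ..
  have hpenz : ∑ q, ∑ l, (∑ j with Linked G S l q j, σ l q j) * entry z q l =
      ∑ l : S p, (∑ j with Linked G S l p j, σ l p j) * (w l - restrict S y p l) := by
    rw [← sub_zero (∑ q, ∑ l, _), ← hpen0, ← Finset.sum_sub_distrib,
      Finset.sum_eq_single p _ (by simp)]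
    · rw [← Finset.sum_sub_distrib, ← sum_coe_eq_sum (s := S p)]
      · refine Finset.sum_congr rfl fun l _ => ?_
        rw [entry_coe, entry_coe, hzp]
        ring
      · intro l hl
        rw [sum_linked_eq_zero hl]
        ring
    · intro q _ hq
      simp only [entry, hzq q hq, sub_self]
  have h1 := hlam y hy z
  rw [lagrangian, lagrangian_penalty_eq, hpen, hpenz] at h1
  have h2 : objective S f y = ((a p + ∑ q ∈ Finset.univ.erase p, a q : ℝ) : WithTop ℝ) := by
    rw [Finset.add_sum_erase _ _ (Finset.mem_univ p), WithTop.coe_sum]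
    exact Finset.sum_congr rfl fun q _ => (ha q).symm
  have h3 : ∑ q, f q (z q) ≤ ((b + ∑ q ∈ Finset.univ.erase p, a q : ℝ) : WithTop ℝ) := by
    rw [← Finset.add_sum_erase _ _ (Finset.mem_univ p), hzp, WithTop.coe_add, WithTop.coe_sum]
    refine add_le_add hw (le_of_eq (Finset.sum_congr rfl fun q hq => ?_))
    rw [hzq q (Finset.ne_of_mem_erase hq), ha q]
  rw [h2] at h1
  have h4 := h1.trans (add_le_add_left h3 _)
  rw [← WithTop.coe_add, WithTop.coe_le_coe] at h4
  have h5 : ∑ l : S p, -(ρ * ∑ j with Linked G S l p j, σ l p j / ρ) * (w l - restrict S y p l) =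
      -∑ l : S p, (∑ j with Linked G S l p j, σ l p j) * (w l - restrict S y p l) := by
    rw [← Finset.sum_neg_distrib]
    refine Finset.sum_congr rfl fun l _ => ?_
    rw [← Finset.sum_div, mul_div_cancel₀ _ hρ.ne', neg_mul]
  rw [h5]
  linarith

/-! ### Convergence of runs. -/

theorem nodeGrad_eq_zero {x : ℕ → Copies S} {k : ℕ} {p : V} {l : Fin n} (h : l ∉ S p) :
    nodeGrad (Linked G S) col (fun k => entry (x k)) k p l = 0 :=
  sum_linked_eq_zero h _

theorem IsRun.lyapunov_succ_le (hf : ∀ p, IsClosedConvexProper (f p)) (hρ : 0 < ρ)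
    {x γ : ℕ → Copies S} (h : IsRun G S f col ρ x γ) {s : Fin n → V → V → ℝ}
    {y : EuclideanSpace ℝ (Fin n)} (hs : IsSaddle G f ρ s y) (k : ℕ) :
    lyapunov (Linked G S) col (fun k => entry (x k)) s y (k + 1)
      + edgeSum (Linked G S) col (fun l i j => (entry (x (k + 1)) i l - entry (x k) j l) ^ 2)
      ≤ lyapunov (Linked G S) col (fun k => entry (x k)) s y k := by
  refine ConnVar.lyapunov_succ_le Linked.symm (Linked.col_ne col) hs.1 fun p => ?_
  refine le_of_eq_of_le (Finset.sum_congr rfl fun l _ => ?_)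
    (sum_mul_nonpos_of_isSubgradient hρ (g' := fun l => ∑ j with Linked G S l p j, s l p j)
      (h.isSubgradient hf k p) (hs.2 p) fun l hl => by
        rw [nodeGrad_eq_zero hl, sum_linked_eq_zero hl])
  by_cases hl : l ∈ S p
  · rw [entry_restrict hl]
  · rw [nodeGrad_eq_zero hl, sum_linked_eq_zero hl]
    ring

theorem IsRun.tendsto (hf : ∀ p, IsClosedConvexProper (f p)) (hρ : 0 < ρ)
    (hwell : ∀ l, ∃ p, l ∈ S p) (hshared : ∀ l, ∃ p q, p ≠ q ∧ l ∈ S p ∧ l ∈ S q)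
    (hconn : IsConnectedVariable G S) (hsaddle : ∃ s y, IsSaddle G f ρ s y)
    {x γ : ℕ → Copies S} (h : IsRun G S f col ρ x γ) :
    ∃ y, IsSolution S f y ∧ ∀ p, Tendsto (fun k => x k p) atTop (𝓝 (restrict S y p)) := by
  obtain ⟨s₀, y₀, h₀⟩ := hsaddle
  have hmem : ∀ {p l}, (∃ j, Linked G S l p j) → l ∈ S p := fun ⟨_, hj⟩ => hj.2.1
  obtain ⟨y, s, φ, hφ, hs, hy, hy', hsd, hgrad⟩ :=
    exists_consensus_cluster (A := Linked G S) (col := col) (X := fun k => entry (x k))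
      Linked.symm (Linked.col_ne col)
      (fun l p q hp hq => reflTransGen_linked hconn (hmem hp) (hmem hq))
      (fun l => (hwell l).imp fun p hp => exists_linked hconn hshared hp)
      (fun k p l hl => entry_of_notMem fun hm => hl (exists_linked hconn hshared hm))
      (h.lyapunov_succ_le hf hρ h₀)
      (fun k p => sum_mul_nonpos_of_isSubgradient hρ (h.isSubgradient hf (k + 1) p)
        (h.isSubgradient hf k p) fun l hl => by rw [nodeGrad_eq_zero hl, nodeGrad_eq_zero hl])
  -- The subgradients at index `φ k` live at the iterate `φ k + 1`, hence the need for the shifted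
  -- limit `hy'`. The new saddle point replaces `s₀`, `y₀` as the reference of the energy.
  have hsad : IsSaddle G f ρ s (WithLp.toLp 2 y) := by
    refine ⟨fun l i j _ => hs l i j, fun p => ?_⟩
    refine isSubgradient_of_tendsto (hf p) (fun k => h.isSubgradient hf (φ k) p)
      (tendsto_euclidean fun l => ?_) fun l => ((hgrad p l).const_mul ρ).neg
    exact (hy' p l (exists_linked hconn hshared l.2)).congr fun k => entry_coe _ _ _
  refine ⟨WithLp.toLp 2 y, hsad.isSolution col, fun p => tendsto_euclidean fun l => ?_⟩
  exact (tendsto_of_lyapunov_subseq Linked.symm (Linked.col_ne col)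
    (h.lyapunov_succ_le hf hρ hsad) hφ hy (fun l i j _ => hsd l i j)
    (exists_linked hconn hshared l.2)).congr fun k => entry_coe _ _ _

end Network

end ConnVar

end

/-- The energy `lyapunov` decreases for every number of colors, by monotonicity of the subgradients
alone, and `tendsto_diff_zero` handles all colors by induction, so the proof covers both cases of
`hcases` at once without using either. -/
theorem mainTheorem3 {V : Type*} [Fintype V] {n C : ℕ}
    (G : SimpleGraph V) (S : V → Finset (Fin n))
    (f : ∀ p : V, EuclideanSpace ℝ (S p) → WithTop ℝ)
    (col : G.Coloring (Fin C)) (ρ : ℝ)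
    (hf : ∀ p, ConnVar.IsClosedConvexProper (f p))
    (hsolv : ∃ x, ConnVar.IsSolution S f x)
    (hdual : ConnVar.StrongDuality G S f col)
    (hSne : ∀ p, (S p).Nonempty)
    (hwell : ∀ l, ∃ p, l ∈ S p)
    (hshared : ∀ l, ∃ p q, p ≠ q ∧ l ∈ S p ∧ l ∈ S q)
    (hG : G.Connected)
    (hcol : Function.Surjective col)
    (hconn : ConnVar.IsConnectedVariable G S)
    (hρ : 0 < ρ)
    (hcases : C = 2 ∨
      ∃ μ : V → ℝ, (∀ p, ConnVar.IsStronglyConvex (μ p) (f p)) ∧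
        ∀ c : Fin C, ρ < (2 * ∑ p ∈ ConnVar.colorSet col c, μ p) /
          (3 * ((C : ℝ) - 1) * (ConnVar.maxDeg G S col c : ℝ))) :
    (∃! s : (ℕ → ConnVar.Copies S) × (ℕ → ConnVar.Copies S),
        ConnVar.IsRun G S f col ρ s.1 s.2) ∧
      ∀ x γ : ℕ → ConnVar.Copies S, ConnVar.IsRun G S f col ρ x γ →
        ∃ xstar : EuclideanSpace ℝ (Fin n), ConnVar.IsSolution S f xstar ∧
          ∀ p, Tendsto (fun k => x k p) atTop (𝓝 (ConnVar.restrict S xstar p)) := by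
  have hsaddle := ConnVar.exists_isSaddle hρ hsolv hdual
  have hdeg := ConnVar.one_le_deg hconn hshared
  refine ⟨?_, fun x γ h => h.tendsto hf hρ hwell hshared hconn hsaddle⟩
  obtain ⟨s, y, hsad⟩ := hsaddle
  obtain ⟨x, γ, h⟩ := ConnVar.exists_isRun (col := col) hf
    (fun p => ⟨_, _, hsad.2 p⟩) hρ hdeg
  refine ⟨(x, γ), h, fun s' h' => ?_⟩
  exact Prod.ext (funext fun k => (h'.unique hf hρ hdeg h k).1)
    (funext fun k => (h'.unique hf hρ hdeg h k).2)
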